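/- Consider the preemptive single-machine scheduling problem with objective total weighted completion time. An instance is a finite set of jobs $J_j$ with release dates $r_j\ge 0$, processing times $p_j>0$ and weights $w_j\ge 0$. The machine processes at most one job at a time, a job may be processed only from its release date on, and it may be interrupted and resumed later without any change of its total processing time. If $C_j$ denotes the completion time of $J_j$, the cost of a schedule is $\sum_j w_j C_j$. A deterministic online algorithm learns of the existence and the parameters of a job only at its release date. Its competitive ratio is the infimum of all $c$ such that, on every instance, its cost is at most $c$ times the optimal (offline) cost of that instance ($+\infty$ if there is no such $c$). Theorem. Every deterministic online algorithm for total weighted completion time scheduling with preemption on a single machine has competitive ratio at least $1.1038$. -/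

import Mathlib

open MeasureTheory

/-- A job with its release date, processing time and weight. -/
structure Job where
  release : ℝ
  proc : ℝ
  weight : ℝ
  release_nonneg : 0 ≤ release
  proc_pos : 0 < proc
  weight_nonneg : 0 ≤ weight

/-- A problem instance is a finite list of jobs, numbered in the order of their arrival;
jobs with the same release date may be listed in any order. -/
structure JobInstance where
  jobs : List Job
  sorted : jobs.Pairwise (fun a b => a.release ≤ b.release)

namespace JobInstance

/-- The jobs that have been released by time `t`. As the list is sorted by release date, they form
an initial segment of it, so that every job keeps its number. -/
noncomputable def known (I : JobInstance) (t : ℝ) : List Job :=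
  I.jobs.filter (fun j => j.release ≤ t)

end JobInstance

/-- The amount of processing that job number `i` has received up to time `t`, where `σ s` is the
number of the job that runs at time `s` (`none` if the machine is idle). -/
noncomputable def processed (σ : ℝ → Option ℕ) (i : ℕ) (t : ℝ) : ENNReal :=
  volume {s : ℝ | s ≤ t ∧ σ s = some i}

/-- `σ` is a feasible preemptive schedule of the instance `I` on a single machine: at every time at
most one job runs, and only after its release; a job may be interrupted and resumed at will; it is
processed for exactly its processing time and is completed at some finite time. -/
structure IsSchedule (I : JobInstance) (σ : ℝ → Option ℕ) : Prop where
  measurable : ∀ i : ℕ, MeasurableSet {s : ℝ | σ s = some i}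
  released : ∀ (s : ℝ) (i : ℕ), σ s = some i → ∃ h : i < I.jobs.length, (I.jobs[i]).release ≤ s
  total : ∀ (i : ℕ) (h : i < I.jobs.length),
    volume {s : ℝ | σ s = some i} = ENNReal.ofReal (I.jobs[i]).proc
  completes : ∀ (i : ℕ) (h : i < I.jobs.length),
    ∃ t : ℝ, processed σ i t = ENNReal.ofReal (I.jobs[i]).proc

/-- The completion time of job number `i`: the first time at which it has received its full
processing time. -/
noncomputable def completionTime (I : JobInstance) (σ : ℝ → Option ℕ)
    (i : Fin I.jobs.length) : ℝ :=
  sInf {t : ℝ | ENNReal.ofReal (I.jobs[i]).proc ≤ processed σ i t}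

/-- The total weighted completion time of a schedule. -/
noncomputable def totalWeightedCompletionTime (I : JobInstance) (σ : ℝ → Option ℕ) : ℝ :=
  ∑ i : Fin I.jobs.length, (I.jobs[i]).weight * completionTime I σ i

/-- The optimal (offline) total weighted completion time of an instance. -/
noncomputable def optimalCost (I : JobInstance) : ℝ :=
  sInf {c : ℝ | ∃ σ : ℝ → Option ℕ, IsSchedule I σ ∧ c = totalWeightedCompletionTime I σ}

/-- A deterministic online algorithm decides at every time `t` which job runs at time `t`, knowing
only `t` and the jobs released by time `t` (its earlier decisions are determined by these data).
On every instance the decisions must form a feasible schedule. -/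
structure OnlineAlgorithm where
  run : List Job → ℝ → Option ℕ
  feasible : ∀ I : JobInstance, IsSchedule I (fun t => run (I.known t) t)

namespace OnlineAlgorithm

/-- The schedule that the algorithm produces on the instance `I`. -/
noncomputable def schedule (A : OnlineAlgorithm) (I : JobInstance) : ℝ → Option ℕ :=
  fun t => A.run (I.known t) t

/-- The algorithm is `c`-competitive: on every instance its cost is at most `c` times the optimal
cost. -/
def IsCompetitive (A : OnlineAlgorithm) (c : ℝ) : Prop :=
  ∀ I : JobInstance, totalWeightedCompletionTime I (A.schedule I) ≤ c * optimalCost I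

/-- The competitive ratio: the infimum of all `c` for which the algorithm is `c`-competitive
(`⊤` if there is none). -/
noncomputable def competitiveRatio (A : OnlineAlgorithm) : EReal :=
  ⨅ (c : ℝ) (_ : A.IsCompetitive c), (c : EReal)

end OnlineAlgorithm

/-! The adversary releases a long and a short job at time `0` and observes how long the algorithm
has run the short job up to time `1`. If it is at most `0.51`, a flood of tiny jobs arrives at
time `1`: an offline schedule, which has completed the short job, processes the flood and then the
long job. Otherwise a flood arrives at time `7 / 3`: an offline schedule, which has completed the
long job, processes the flood and then the short job. Either way the algorithm is left with a
remainder of the wrong job. Even if it continues optimally, that is by Smith's rule, each pair of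
jobs `i`, `j` with remainders `x i`, `x j` costs it a delay of at least
`min (w i * x j) (w j * x i)`. Dividing a flood of weight `W` and processing time `P` into `n`
parts lets it behave like a fluid: the discretisation adds only `W * P / (2 * n)` to both costs.
-/

/-- The amount of processing that job number `i` has received up to time `t`, as a real number. -/
noncomputable def processedReal (σ : ℝ → Option ℕ) (i : ℕ) (t : ℝ) : ℝ :=
  (processed σ i t).toReal

/-- The amount of processing that job number `i` of `I` still needs at time `t`. The schedule `σ`
may belong to a larger instance in which the jobs of `I` keep their numbers. -/
noncomputable def remaining (I : JobInstance) (σ : ℝ → Option ℕ) (t : ℝ)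
    (i : Fin I.jobs.length) : ℝ :=
  (I.jobs[i]).proc - processedReal σ i t

lemma processedReal_nonneg (σ : ℝ → Option ℕ) (i : ℕ) (t : ℝ) : 0 ≤ processedReal σ i t :=
  ENNReal.toReal_nonneg

section SmithCost

variable {ι : Type*} [Fintype ι]

/-- The minimum of `∑ i, w i * C i` when jobs of weights `w i` and processing times `x i` are all
available at time `0`; it is attained by Smith's rule (nonincreasing `w i / x i`). Every pair of
jobs contributes the cheaper of the two possible delays; the first sum makes up for halving the
diagonal terms of the second. -/
noncomputable def smithCost (w x : ι → ℝ) : ℝ :=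
  (∑ i, w i * x i + ∑ i, ∑ j, min (w i * x j) (w j * x i)) / 2

lemma smithCost_comp_equiv {κ : Type*} [Fintype κ] (e : κ ≃ ι) (w x : ι → ℝ) :
    smithCost (w ∘ e) (x ∘ e) = smithCost w x := by
  have hinner (i : ι) : ∑ j, min (w i * x (e j)) (w (e j) * x i)
      = ∑ j, min (w i * x j) (w j * x i) := e.sum_comp fun j => min (w i * x j) (w j * x i)
  simp only [smithCost, Function.comp_apply, hinner]
  rw [e.sum_comp fun i => w i * x i, e.sum_comp fun i => ∑ j, min (w i * x j) (w j * x i)]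

lemma smithCost_fin_two (w x : Fin 2 → ℝ) :
    smithCost w x = w 0 * x 0 + w 1 * x 1 + min (w 0 * x 1) (w 1 * x 0) := by
  simp only [smithCost, Fin.sum_univ_two, min_self, min_comm (w 1 * x 0)]
  ring

lemma smithCost_sumElim_div (w x : ι → ℝ) (W P : ℝ) (n : ℕ) [NeZero n] :
    smithCost (Sum.elim w fun _ : Fin n => W / n) (Sum.elim x fun _ : Fin n => P / n)
      = smithCost w x + ∑ i, min (w i * P) (W * x i) + W * P * (1 + 1 / n) / 2 := by
  have hn : (n : ℝ) ≠ 0 := NeZero.ne _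
  have hmin (i : ι) :
      n * min (w i * (P / n)) (W / n * x i) = min (w i * P) (W * x i) := by
    rw [mul_min_of_nonneg _ _ n.cast_nonneg]
    congr 1 <;> field_simp
  simp only [smithCost, Fintype.sum_sum_type, Sum.elim_inl, Sum.elim_inr, Finset.sum_const,
    Finset.card_univ, Fintype.card_fin, nsmul_eq_mul, min_self, Finset.sum_add_distrib, hmin,
    min_comm (W / n * x _)]
  rw [Finset.mul_sum, Finset.sum_congr rfl fun i _ => hmin i]
  field_simp
  ring

/-- Here `D i j` is the amount of work on job `j` that precedes the completion of job `i`. -/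
lemma smithCost_le_sum_mul_sum {w x : ι → ℝ} {D : ι → ι → ℝ} (hw : ∀ i, 0 ≤ w i)
    (hD : ∀ i j, 0 ≤ D i j) (hx : ∀ i j, x j ≤ D i j ∨ x i ≤ D j i) :
    smithCost w x ≤ ∑ i, w i * ∑ j, D i j := by
  classical
  have hpair (i j : ι) : (if i = j then w i * x i else 0) + min (w i * x j) (w j * x i)
      ≤ w i * D i j + w j * D j i := by
    split_ifs with hij
    · subst hij
      have := mul_le_mul_of_nonneg_left ((hx i i).elim id id) (hw i)
      rw [min_self]
      linarith
    · rw [zero_add]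
      rcases hx i j with h | h
      · exact (min_le_left _ _).trans <| (mul_le_mul_of_nonneg_left h (hw i)).trans <|
          le_add_of_nonneg_right (mul_nonneg (hw j) (hD j i))
      · exact (min_le_right _ _).trans <| (mul_le_mul_of_nonneg_left h (hw j)).trans <|
          le_add_of_nonneg_left (mul_nonneg (hw i) (hD i j))
  have hsum := Finset.sum_le_sum fun i (_ : i ∈ Finset.univ) =>
    Finset.sum_le_sum fun j (_ : j ∈ Finset.univ) => hpair i j
  simp only [Finset.sum_add_distrib, Finset.sum_ite_eq, Finset.mem_univ, if_true] at hsum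
  rw [Finset.sum_comm (f := fun i j => w j * D j i)] at hsum
  simp only [smithCost, Finset.mul_sum]
  linarith

end SmithCost

namespace IsSchedule

variable {I : JobInstance} {σ : ℝ → Option ℕ}

lemma processed_le (h : IsSchedule I σ) (i : Fin I.jobs.length) (t : ℝ) :
    processed σ i t ≤ ENNReal.ofReal (I.jobs[i]).proc :=
  (measure_mono fun _ hs => hs.2).trans_eq (h.total i i.2)

lemma processed_ne_top (h : IsSchedule I σ) (i : Fin I.jobs.length) (t : ℝ) :
    processed σ i t ≠ ⊤ :=
  ((h.processed_le i t).trans_lt ENNReal.ofReal_lt_top).ne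

lemma processedReal_le (h : IsSchedule I σ) (i : Fin I.jobs.length) (t : ℝ) :
    processedReal σ i t ≤ (I.jobs[i]).proc :=
  ENNReal.toReal_le_of_le_ofReal (I.jobs[i]).proc_pos.le (h.processed_le i t)

lemma processedReal_mono (h : IsSchedule I σ) (i : Fin I.jobs.length) :
    Monotone (processedReal σ i) := fun _ _ hst =>
  ENNReal.toReal_mono (h.processed_ne_top i _)
    (measure_mono fun _ hs => ⟨hs.1.trans hst, hs.2⟩)

lemma processedReal_eq_zero (h : IsSchedule I σ) (i : Fin I.jobs.length) {t : ℝ}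
    (ht : t ≤ (I.jobs[i]).release) : processedReal σ i t = 0 := by
  have hsub : {s | s ≤ t ∧ σ s = some (i : ℕ)} ⊆ {t} := fun s hs =>
    le_antisymm hs.1 (ht.trans (h.released s i hs.2).2)
  rw [processedReal, processed, measure_mono_null hsub Real.volume_singleton, ENNReal.toReal_zero]

lemma processedReal_sub (h : IsSchedule I σ) (i : Fin I.jobs.length) {s t : ℝ} (hst : s ≤ t) :
    processedReal σ i t - processedReal σ i s
      = volume.real ({r | σ r = some (i : ℕ)} ∩ Set.Ioc s t) := by
  have hdiff : {r | σ r = some (i : ℕ)} ∩ Set.Ioc s t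
      = {r | r ≤ t ∧ σ r = some (i : ℕ)} \ {r | r ≤ s ∧ σ r = some (i : ℕ)} := by
    ext r
    simp only [Set.mem_inter_iff, Set.mem_ofPred_eq, Set.mem_Ioc, Set.mem_sdiff, ← not_le]
    tauto
  have hsub : {r | r ≤ s ∧ σ r = some (i : ℕ)} ⊆ {r | r ≤ t ∧ σ r = some (i : ℕ)} :=
    fun r hr => ⟨hr.1.trans hst, hr.2⟩
  rw [hdiff, measureReal_sdiff hsub (measurableSet_Iic.inter (h.measurable i))
    (h.processed_ne_top i t)]
  rfl

lemma sum_processedReal_sub_le (h : IsSchedule I σ) {s t : ℝ} (hst : s ≤ t) :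
    ∑ i : Fin I.jobs.length, (processedReal σ i t - processedReal σ i s) ≤ t - s := by
  have hdisj : Pairwise (Function.onFun Disjoint
      fun i : Fin I.jobs.length => {r | σ r = some (i : ℕ)} ∩ Set.Ioc s t) := fun i j hij =>
    Set.disjoint_left.2 fun r hi hj =>
      hij (Fin.ext (Option.some_injective _ (hi.1.symm.trans hj.1)))
  calc ∑ i : Fin I.jobs.length, (processedReal σ i t - processedReal σ i s)
      = volume.real (⋃ i : Fin I.jobs.length, {r | σ r = some (i : ℕ)} ∩ Set.Ioc s t) := by
        simp_rw [h.processedReal_sub _ hst]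
        exact (measureReal_iUnion_fintype hdisj
          (fun i => (h.measurable i).inter measurableSet_Ioc)
          (fun i => measure_ne_top_of_subset Set.inter_subset_right measure_Ioc_lt_top.ne)).symm
    _ ≤ volume.real (Set.Ioc s t) :=
        measureReal_mono (Set.iUnion_subset fun _ => Set.inter_subset_right)
          measure_Ioc_lt_top.ne
    _ = t - s := Real.volume_real_Ioc_of_le hst

lemma sum_processedReal_le (h : IsSchedule I σ) {t : ℝ} (ht : 0 ≤ t) :
    ∑ i : Fin I.jobs.length, processedReal σ i t ≤ t := by
  simpa [h.processedReal_eq_zero _ (Job.release_nonneg _)] using h.sum_processedReal_sub_le ht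

lemma processedReal_sub_le (h : IsSchedule I σ) (i : Fin I.jobs.length) {s t : ℝ} (hst : s ≤ t) :
    processedReal σ i t - processedReal σ i s ≤ t - s :=
  (Finset.single_le_sum
    (f := fun j : Fin I.jobs.length => processedReal σ j t - processedReal σ j s)
    (fun j _ => sub_nonneg.2 (h.processedReal_mono j hst)) (Finset.mem_univ i)).trans
    (h.sum_processedReal_sub_le hst)

lemma release_le_of_proc_le (h : IsSchedule I σ) (i : Fin I.jobs.length) {t : ℝ}
    (ht : ENNReal.ofReal (I.jobs[i]).proc ≤ processed σ i t) : (I.jobs[i]).release ≤ t := by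
  by_contra! hlt
  have hpos := (I.jobs[i]).proc_pos
  rw [ENNReal.ofReal_le_iff_le_toReal (h.processed_ne_top i t)] at ht
  exact (hpos.trans_le ht).ne' (h.processedReal_eq_zero i hlt.le)

lemma completionTime_le (h : IsSchedule I σ) (i : Fin I.jobs.length) {t : ℝ}
    (ht : ENNReal.ofReal (I.jobs[i]).proc ≤ processed σ i t) : completionTime I σ i ≤ t :=
  csInf_le ⟨_, fun _ hs => h.release_le_of_proc_le i hs⟩ ht

lemma nonempty_setOf_proc_le (h : IsSchedule I σ) (i : Fin I.jobs.length) :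
    {t : ℝ | ENNReal.ofReal (I.jobs[i]).proc ≤ processed σ i t}.Nonempty :=
  (h.completes i i.2).imp fun _ ht => ht.ge

lemma release_le_completionTime (h : IsSchedule I σ) (i : Fin I.jobs.length) :
    (I.jobs[i]).release ≤ completionTime I σ i :=
  le_csInf (h.nonempty_setOf_proc_le i) fun _ ht => h.release_le_of_proc_le i ht

lemma processedReal_completionTime (h : IsSchedule I σ) (i : Fin I.jobs.length) :
    processedReal σ i (completionTime I σ i) = (I.jobs[i]).proc := by
  -- The processed amount is `1`-Lipschitz in time, so the infimum is attained.
  refine le_antisymm (h.processedReal_le i _) (le_of_forall_pos_le_add fun ε hε => ?_)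
  obtain ⟨t, ht, hlt⟩ := exists_lt_of_csInf_lt (h.nonempty_setOf_proc_le i)
    (show completionTime I σ i < completionTime I σ i + ε by linarith)
  have hproc := (ENNReal.ofReal_le_iff_le_toReal (h.processed_ne_top i t)).1 ht
  have hlip := h.processedReal_sub_le i (h.completionTime_le i ht)
  unfold processedReal at hlip ⊢
  linarith

lemma processedReal_of_completionTime_le (h : IsSchedule I σ) (i : Fin I.jobs.length) {t : ℝ}
    (ht : completionTime I σ i ≤ t) : processedReal σ i t = (I.jobs[i]).proc :=
  (h.processedReal_le i t).antisymm
    ((h.processedReal_completionTime i).ge.trans (h.processedReal_mono i ht))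

lemma le_completionTime_of_remaining_pos (h : IsSchedule I σ) (i : Fin I.jobs.length) {t : ℝ}
    (ht : 0 < remaining I σ t i) : t ≤ completionTime I σ i := by
  by_contra! hlt
  exact ht.ne' (sub_eq_zero.2 (h.processedReal_of_completionTime_le i hlt.le).symm)

lemma release_add_proc_le_completionTime (h : IsSchedule I σ) (i : Fin I.jobs.length) :
    (I.jobs[i]).release + (I.jobs[i]).proc ≤ completionTime I σ i := by
  have hlip := h.processedReal_sub_le i (h.release_le_completionTime i)
  rw [h.processedReal_completionTime i, h.processedReal_eq_zero i le_rfl] at hlip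
  linarith

lemma totalWeightedCompletionTime_nonneg (h : IsSchedule I σ) :
    0 ≤ totalWeightedCompletionTime I σ :=
  Finset.sum_nonneg fun i _ => mul_nonneg (I.jobs[i]).weight_nonneg
    ((I.jobs[i]).release_nonneg.trans (h.release_le_completionTime i))

lemma optimalCost_le (h : IsSchedule I σ) : optimalCost I ≤ totalWeightedCompletionTime I σ :=
  csInf_le ⟨0, by rintro _ ⟨τ, hτ, rfl⟩; exact hτ.totalWeightedCompletionTime_nonneg⟩ ⟨σ, h, rfl⟩

/-- The last sum corrects for the jobs that are completed before time `t`. -/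
lemma smithCost_remaining_le (h : IsSchedule I σ) (t : ℝ) :
    (∑ i : Fin I.jobs.length, (I.jobs[i]).weight) * t
        + smithCost (fun i => (I.jobs[i]).weight) (remaining I σ t)
      ≤ totalWeightedCompletionTime I σ
        + ∑ i, (I.jobs[i]).weight * max (t - completionTime I σ i) 0 := by
  set C := completionTime I σ
  set w : Fin I.jobs.length → ℝ := fun i => (I.jobs[i]).weight
  have hw (i) : 0 ≤ w i := (I.jobs[i]).weight_nonneg
  let D (i j : Fin I.jobs.length) : ℝ := processedReal σ j (max t (C i)) - processedReal σ j t
  have hD (i j) : 0 ≤ D i j := sub_nonneg.2 (h.processedReal_mono j (le_max_left _ _))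
  have hrem (i j) (hij : C j ≤ C i) : remaining I σ t j ≤ D i j := by
    simp only [D, remaining]
    rw [h.processedReal_of_completionTime_le j (hij.trans (le_max_right _ _))]
  calc (∑ i, w i) * t + smithCost w (remaining I σ t)
      ≤ (∑ i, w i) * t + ∑ i, w i * ∑ j, D i j := by
        gcongr
        exact smithCost_le_sum_mul_sum hw hD fun i j => (le_total _ _).imp (hrem i j) (hrem j i)
    _ ≤ (∑ i, w i) * t + ∑ i, w i * (max t (C i) - t) := by
        gcongr with i
        · exact hw i
        · exact h.sum_processedReal_sub_le (le_max_left _ _)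
    _ = totalWeightedCompletionTime I σ + ∑ i, w i * max (t - C i) 0 := by
        rw [totalWeightedCompletionTime, Finset.sum_mul, ← Finset.sum_add_distrib,
          ← Finset.sum_add_distrib]
        refine Finset.sum_congr rfl fun i _ => ?_
        rw [← sub_self (C i), max_sub_sub_right]
        ring

end IsSchedule

lemma optimalCost_nonneg (I : JobInstance) : 0 ≤ optimalCost I :=
  Real.sInf_nonneg (by rintro _ ⟨σ, hσ, rfl⟩; exact hσ.totalWeightedCompletionTime_nonneg)

/-- The jobs of `I` can be processed without interruption from the times `start i` on. -/
structure IsStartDates (I : JobInstance) (start : Fin I.jobs.length → ℝ) : Prop where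
  release_le : ∀ i, (I.jobs[i]).release ≤ start i
  disjoint : Pairwise (Function.onFun Disjoint
    fun i => Set.Ico (start i) (start i + (I.jobs[i]).proc))

/-- The nonpreemptive schedule that processes job number `i` from time `start i` on. -/
noncomputable def blockSchedule (I : JobInstance) (start : Fin I.jobs.length → ℝ) (s : ℝ) :
    Option ℕ :=
  open Classical in
  if h : ∃ i, s ∈ Set.Ico (start i) (start i + (I.jobs[i]).proc) then some h.choose else none

namespace IsStartDates

variable {I : JobInstance} {start : Fin I.jobs.length → ℝ}

lemma blockSchedule_eq_some_iff (h : IsStartDates I start) {i : ℕ} {s : ℝ} :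
    blockSchedule I start s = some i ↔ ∃ hi : i < I.jobs.length,
      s ∈ Set.Ico (start ⟨i, hi⟩) (start ⟨i, hi⟩ + (I.jobs[i]).proc) := by
  unfold blockSchedule
  split_ifs with hs
  · rw [Option.some_inj]
    refine ⟨fun heq => heq ▸ ⟨hs.choose.2, hs.choose_spec⟩, fun ⟨hi, hmem⟩ => ?_⟩
    by_contra hne
    exact Set.disjoint_left.1 (h.disjoint (i := hs.choose) (j := ⟨i, hi⟩) (hne ∘ congrArg Fin.val))
      hs.choose_spec hmem
  · exact ⟨nofun, fun ⟨hi, hmem⟩ => absurd ⟨⟨i, hi⟩, hmem⟩ hs⟩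

lemma setOf_blockSchedule_eq (h : IsStartDates I start) (i : Fin I.jobs.length) :
    {s | blockSchedule I start s = some (i : ℕ)}
      = Set.Ico (start i) (start i + (I.jobs[i]).proc) :=
  Set.ext fun _ => h.blockSchedule_eq_some_iff.trans (exists_prop_of_true i.2)

lemma processed_blockSchedule (h : IsStartDates I start) (i : Fin I.jobs.length) :
    processed (blockSchedule I start) i (start i + (I.jobs[i]).proc)
      = ENNReal.ofReal (I.jobs[i]).proc := by
  have hset : {s | s ≤ start i + (I.jobs[i]).proc ∧ blockSchedule I start s = some (i : ℕ)}
      = Set.Ico (start i) (start i + (I.jobs[i]).proc) := by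
    rw [Set.ofPred_and, h.setOf_blockSchedule_eq]
    exact Set.inter_eq_right.2 fun _ hs => hs.2.le
  rw [processed, hset, Real.volume_Ico, add_sub_cancel_left]

lemma isSchedule_blockSchedule (h : IsStartDates I start) :
    IsSchedule I (blockSchedule I start) where
  measurable i := by
    by_cases hi : i < I.jobs.length
    · exact h.setOf_blockSchedule_eq ⟨i, hi⟩ ▸ measurableSet_Ico
    · simp [h.blockSchedule_eq_some_iff, hi]
  released s i hs := by
    obtain ⟨hi, hmem⟩ := h.blockSchedule_eq_some_iff.1 hs
    exact ⟨hi, (h.release_le ⟨i, hi⟩).trans hmem.1⟩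
  total i hi :=
    (congrArg volume (h.setOf_blockSchedule_eq ⟨i, hi⟩)).trans (by simp)
  completes i hi := ⟨_, h.processed_blockSchedule ⟨i, hi⟩⟩

lemma optimalCost_le (h : IsStartDates I start) :
    optimalCost I ≤ ∑ i, (I.jobs[i]).weight * (start i + (I.jobs[i]).proc) :=
  h.isSchedule_blockSchedule.optimalCost_le.trans <| Finset.sum_le_sum fun i _ =>
    mul_le_mul_of_nonneg_left
      (h.isSchedule_blockSchedule.completionTime_le i (h.processed_blockSchedule i).ge)
      (I.jobs[i]).weight_nonneg

end IsStartDates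

/-- One of `n` equal parts into which the job `J` is divided. -/
noncomputable def Job.split (J : Job) (n : ℕ) [NeZero n] : Job where
  release := J.release
  proc := J.proc / n
  weight := J.weight / n
  release_nonneg := J.release_nonneg
  proc_pos := div_pos J.proc_pos (Nat.cast_pos.2 (NeZero.pos n))
  weight_nonneg := div_nonneg J.weight_nonneg n.cast_nonneg

/-- The time at which part number `k` of `F` starts when its `n` parts are processed one after the
other from the release date on. -/
noncomputable def Job.partStart (F : Job) (n k : ℕ) : ℝ :=
  F.release + k * (F.proc / n)

namespace Job

variable (F : Job) (n : ℕ)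

lemma partStart_zero : F.partStart n 0 = F.release := by simp [partStart]

lemma partStart_self [NeZero n] : F.partStart n n = F.release + F.proc := by
  rw [partStart, mul_div_cancel₀ _ (NeZero.ne (n : ℝ))]

lemma partStart_succ [NeZero n] (k : ℕ) :
    F.partStart n (k + 1) = F.partStart n k + (F.split n).proc := by
  simp only [partStart, split]
  push_cast
  ring

lemma partStart_mono : Monotone (F.partStart n) := fun _ _ hkl => by
  have := F.proc_pos
  unfold partStart
  gcongr

lemma sum_partStart_mul_two (m : ℕ) :
    (∑ k ∈ Finset.range m, F.partStart n k) * 2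
      = m * (2 * F.release + (m - 1) * (F.proc / n)) := by
  induction m with
  | zero => simp
  | succ m ih =>
    rw [Finset.sum_range_succ, add_mul, ih, partStart]
    push_cast
    ring

lemma sum_split_weight [NeZero n] : ∑ _k : Fin n, (F.split n).weight = F.weight := by
  rw [Finset.sum_const, Finset.card_univ, Fintype.card_fin, nsmul_eq_mul, split,
    mul_div_cancel₀ _ (NeZero.ne (n : ℝ))]

lemma sum_split_weight_mul_partStart [NeZero n] :
    ∑ k : Fin n, (F.split n).weight * (F.partStart n k + (F.split n).proc)
      = F.weight * (F.release + F.proc * (1 + 1 / n) / 2) := by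
  have hn : (n : ℝ) ≠ 0 := NeZero.ne _
  have hsum := F.sum_partStart_mul_two n n
  rw [← Fin.sum_univ_eq_sum_range] at hsum
  rw [← Finset.mul_sum, Finset.sum_add_distrib, eq_div_of_mul_eq two_ne_zero hsum]
  simp only [split, Finset.sum_const, Finset.card_univ, Fintype.card_fin, nsmul_eq_mul]
  field_simp
  ring

end Job

namespace JobInstance

/-- The instance `I` followed by a flood of `n` tiny jobs, the equal parts of `F`. -/
noncomputable def flood (I : JobInstance) (F : Job) (hF : ∀ j ∈ I.jobs, j.release ≤ F.release)
    (n : ℕ) [NeZero n] : JobInstance where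
  jobs := I.jobs ++ List.replicate n (F.split n)
  sorted := List.pairwise_append.2 ⟨I.sorted, List.pairwise_replicate.2 (Or.inr le_rfl),
    fun j hj _ hk => (List.eq_of_mem_replicate hk) ▸ hF j hj⟩

variable {I : JobInstance} {F : Job} {hF : ∀ j ∈ I.jobs, j.release ≤ F.release}
  {n : ℕ} [NeZero n]

lemma known_flood_of_lt {t : ℝ} (ht : t < F.release) : (I.flood F hF n).known t = I.known t := by
  simp [known, flood, Job.split, ht]

variable (hF n) in
/-- The numbers of the jobs of a flooded instance: first those of `I`, then those of the flood. -/
noncomputable def floodEquiv : Fin I.jobs.length ⊕ Fin n ≃ Fin (I.flood F hF n).jobs.length :=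
  finSumFinEquiv.trans (finCongr (by simp [flood]))

lemma flood_getElem_inl (i : Fin I.jobs.length) :
    (I.flood F hF n).jobs[floodEquiv hF n (.inl i)] = I.jobs[i] :=
  List.getElem_append_left i.2

lemma flood_getElem_inr (k : Fin n) :
    (I.flood F hF n).jobs[floodEquiv hF n (.inr k)] = F.split n :=
  (List.getElem_append_right (by simp [floodEquiv])).trans (by simp)

lemma weight_comp_floodEquiv :
    (fun i => ((I.flood F hF n).jobs[i]).weight) ∘ floodEquiv hF n
      = Sum.elim (fun i : Fin I.jobs.length => (I.jobs[i]).weight) fun _ => F.weight / n := by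
  ext (i | k)
  · rw [Function.comp_apply, flood_getElem_inl, Sum.elim_inl]
  · rw [Function.comp_apply, flood_getElem_inr, Sum.elim_inr, Job.split]

lemma sum_flood (f : Fin (I.flood F hF n).jobs.length → ℝ) :
    ∑ i, f i = ∑ i, f (floodEquiv hF n (.inl i)) + ∑ k, f (floodEquiv hF n (.inr k)) := by
  rw [← (floodEquiv hF n).sum_comp, Fintype.sum_sum_type]

end JobInstance

namespace IsStartDates

variable {I : JobInstance} {start : Fin I.jobs.length → ℝ} {F : Job} {n : ℕ} [NeZero n]

lemma flood (h : IsStartDates I start) (hF : ∀ j ∈ I.jobs, j.release ≤ F.release)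
    (hdisj : ∀ i, Disjoint (Set.Ico (start i) (start i + (I.jobs[i]).proc))
      (Set.Ico F.release (F.release + F.proc))) :
    IsStartDates (I.flood F hF n) (Sum.elim start (fun k : Fin n => F.partStart n k) ∘
      (JobInstance.floodEquiv hF n).symm) := by
  set e := JobInstance.floodEquiv hF n
  have hrel (k : ℕ) : F.release ≤ F.partStart n k :=
    (F.partStart_zero n).ge.trans (F.partStart_mono n k.zero_le)
  have hsub (k : Fin n) : Set.Ico (F.partStart n k) (F.partStart n k + (F.split n).proc)
      ⊆ Set.Ico F.release (F.release + F.proc) := by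
    rw [← F.partStart_succ, ← F.partStart_self n]
    exact Set.Ico_subset_Ico (hrel k) (F.partStart_mono n k.2)
  have hparts : Pairwise (Function.onFun Disjoint fun k : Fin n =>
      Set.Ico (F.partStart n k) (F.partStart n k + (F.split n).proc)) := by
    simp only [← F.partStart_succ]
    exact (F.partStart_mono n).pairwise_disjoint_on_Ico_succ.comp_of_injective Fin.val_injective
  refine ⟨e.surjective.forall.2 ?_, Pairwise.of_comp_of_surjective ?_ e.surjective⟩
  · rintro (i | k) <;>
      simp only [Function.comp_apply, e, Equiv.symm_apply_apply, Sum.elim_inl, Sum.elim_inr,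
        JobInstance.flood_getElem_inl, JobInstance.flood_getElem_inr]
    exacts [h.release_le i, hrel k]
  · rintro (i | k) (j | l) hne <;>
      simp only [Function.onFun, Function.comp_apply, e, Equiv.symm_apply_apply, Sum.elim_inl,
        Sum.elim_inr, JobInstance.flood_getElem_inl, JobInstance.flood_getElem_inr]
    · exact h.disjoint (ne_of_apply_ne Sum.inl hne)
    · exact (hdisj i).mono_right (hsub l)
    · exact ((hdisj j).mono_right (hsub k)).symm
    · exact hparts (ne_of_apply_ne Sum.inr hne)

lemma optimalCost_flood_le (h : IsStartDates I start)
    (hF : ∀ j ∈ I.jobs, j.release ≤ F.release)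
    (hdisj : ∀ i, Disjoint (Set.Ico (start i) (start i + (I.jobs[i]).proc))
      (Set.Ico F.release (F.release + F.proc))) :
    optimalCost (I.flood F hF n) ≤ ∑ i, (I.jobs[i]).weight * (start i + (I.jobs[i]).proc)
      + F.weight * (F.release + F.proc * (1 + 1 / n) / 2) := by
  refine (h.flood hF hdisj).optimalCost_le.trans_eq ?_
  simp only [JobInstance.sum_flood, Function.comp_apply, Equiv.symm_apply_apply, Sum.elim_inl,
    Sum.elim_inr, JobInstance.flood_getElem_inl, JobInstance.flood_getElem_inr,
    F.sum_split_weight_mul_partStart n]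

end IsStartDates

namespace IsSchedule

variable {I : JobInstance} {F : Job} {hF : ∀ j ∈ I.jobs, j.release ≤ F.release} {n : ℕ} [NeZero n]
  {σ : ℝ → Option ℕ}

lemma sum_processedReal_flood_le (h : IsSchedule (I.flood F hF n) σ) {t : ℝ} (ht : 0 ≤ t) :
    ∑ i : Fin I.jobs.length, processedReal σ i t ≤ t := by
  have hsum := h.sum_processedReal_le ht
  rw [JobInstance.sum_flood] at hsum
  exact (le_add_of_nonneg_right (Finset.sum_nonneg fun _ _ => processedReal_nonneg _ _ _)).trans
    hsum

lemma remaining_comp_floodEquiv (h : IsSchedule (I.flood F hF n) σ) :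
    remaining (I.flood F hF n) σ F.release ∘ JobInstance.floodEquiv hF n
      = Sum.elim (remaining I σ F.release) fun _ => F.proc / n := by
  ext (i | k)
  · rw [Function.comp_apply, remaining, JobInstance.flood_getElem_inl]
    rfl
  · have hzero := h.processedReal_eq_zero (JobInstance.floodEquiv hF n (.inr k)) (t := F.release)
      (by rw [JobInstance.flood_getElem_inr]; exact le_rfl)
    rw [Function.comp_apply, remaining, hzero, JobInstance.flood_getElem_inr, sub_zero]
    rfl

lemma smithCost_flood_le (h : IsSchedule (I.flood F hF n) σ) :
    (∑ i : Fin I.jobs.length, (I.jobs[i]).weight) * F.release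
        + smithCost (fun i => (I.jobs[i]).weight) (remaining I σ F.release)
        + ∑ i, min ((I.jobs[i]).weight * F.proc) (F.weight * remaining I σ F.release i)
        + F.weight * (F.release + F.proc * (1 + 1 / n) / 2)
      ≤ totalWeightedCompletionTime (I.flood F hF n) σ
        + ∑ i, (I.jobs[i]).weight * max (F.release
          - completionTime (I.flood F hF n) σ (JobInstance.floodEquiv hF n (.inl i))) 0 := by
  have hmax (k : Fin n) : max (F.release
      - completionTime (I.flood F hF n) σ (JobInstance.floodEquiv hF n (.inr k))) 0 = 0 := by
    have hrel := h.release_le_completionTime (JobInstance.floodEquiv hF n (.inr k))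
    rw [JobInstance.flood_getElem_inr] at hrel
    exact max_eq_right (sub_nonpos.2 hrel)
  have hsmith := h.smithCost_remaining_le F.release
  rw [← smithCost_comp_equiv (JobInstance.floodEquiv hF n), JobInstance.weight_comp_floodEquiv,
    h.remaining_comp_floodEquiv, smithCost_sumElim_div] at hsmith
  simp only [JobInstance.sum_flood, JobInstance.flood_getElem_inl, JobInstance.flood_getElem_inr,
    F.sum_split_weight n, hmax, mul_zero, Finset.sum_const_zero, add_zero] at hsmith
  linarith

end IsSchedule

namespace OnlineAlgorithm

lemma processedReal_schedule_congr (A : OnlineAlgorithm) {I J : JobInstance} {t : ℝ}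
    (h : ∀ s < t, I.known s = J.known s) (i : ℕ) :
    processedReal (A.schedule I) i t = processedReal (A.schedule J) i t := by
  refine congrArg ENNReal.toReal (measure_congr ?_)
  filter_upwards [Measure.ae_ne volume t] with s hs
  refine propext (and_congr_right fun hst => ?_)
  rw [schedule, schedule, h s (hst.lt_of_ne hs)]

lemma le_competitiveRatio (A : OnlineAlgorithm) {I : JobInstance} {r U : ℝ} (hr : 0 < r)
    (hU : 0 < U) (hopt : optimalCost I ≤ U)
    (hcost : r * U ≤ totalWeightedCompletionTime I (A.schedule I)) :
    (r : EReal) ≤ A.competitiveRatio := by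
  refine le_iInf₂ fun c hc => EReal.coe_le_coe_iff.2 ?_
  by_contra! hcr
  have hlt : c * optimalCost I < r * U := by
    rcases le_or_gt c 0 with hc0 | hc0
    · exact (mul_nonpos_of_nonpos_of_nonneg hc0 (optimalCost_nonneg I)).trans_lt (mul_pos hr hU)
    · exact (mul_le_mul_of_nonneg_left hopt hc0.le).trans_lt (mul_lt_mul_of_pos_right hcr hU)
  exact (hcost.trans (hc I)).not_gt hlt

end OnlineAlgorithm

section Adversary

/-- The long one of the two jobs that the adversary releases at time `0`. -/
noncomputable def longJob : Job where
  release := 0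
  proc := 7 / 3
  weight := 7 / 3
  release_nonneg := le_rfl
  proc_pos := by norm_num
  weight_nonneg := by norm_num

/-- The short one of the two jobs that the adversary releases at time `0`. -/
def shortJob : Job where
  release := 0
  proc := 1
  weight := 1
  release_nonneg := le_rfl
  proc_pos := one_pos
  weight_nonneg := zero_le_one

/-- The two jobs that the adversary releases at time `0`, the long job being number `0`. -/
noncomputable def baseInstance : JobInstance where
  jobs := [longJob, shortJob]
  sorted := List.pairwise_pair.2 le_rfl

/-- The flood that punishes an algorithm which has neglected the short job up to time `1`. Its
density `7 / 4` is the one that the remainder of the long job has at time `1` if the long job has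
been running all the time. -/
noncomputable def earlyFlood : Job where
  release := 1
  proc := 16 / 5
  weight := 28 / 5
  release_nonneg := zero_le_one
  proc_pos := by norm_num
  weight_nonneg := by norm_num

/-- The flood that punishes an algorithm which has spent time on the short job up to time `1`. It
arrives when the long job could have been completed; its density `7 / 3` is the one that the
remainder of the long job then has if the short job has been completed. -/
noncomputable def lateFlood : Job where
  release := 7 / 3
  proc := 11 / 4
  weight := 77 / 12
  release_nonneg := by norm_num
  proc_pos := by norm_num
  weight_nonneg := by norm_num

lemma release_le_of_mem_baseInstance (F : Job) :
    ∀ j ∈ baseInstance.jobs, j.release ≤ F.release := by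
  simp [baseInstance, longJob, shortJob, F.release_nonneg]

/-- The adversary's instance: long and short job, then `F` as flood of `n` parts. -/
noncomputable def floodedBase (F : Job) (n : ℕ) [NeZero n] : JobInstance :=
  baseInstance.flood F (release_le_of_mem_baseInstance F) n

/-- The cost of the schedule of `floodedBase F n` that processes the long job from time `a` on, the
short job from time `b` on, and the flood from its release date on, none with an interruption. -/
noncomputable def offlineCost (F : Job) (n : ℕ) (a b : ℝ) : ℝ :=
  7 / 3 * (a + 7 / 3) + (b + 1) + F.weight * (F.release + F.proc * (1 + 1 / n) / 2)

/-- The cost of a schedule of `floodedBase F n` that continues by Smith's rule when the flood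
arrives, with amounts `x > 0` of the long and `y > 0` of the short job still to be processed. -/
noncomputable def smithContinuation (F : Job) (n : ℕ) (x y : ℝ) : ℝ :=
  7 / 3 * (F.release + x) + (F.release + y) + min (7 / 3 * y) x
    + min (7 / 3 * F.proc) (F.weight * x) + min F.proc (F.weight * y)
    + F.weight * (F.release + F.proc * (1 + 1 / n) / 2)

lemma ratio_mul_le_smithContinuation_earlyFlood {n : ℕ} {x y : ℝ} (hn : (10 : ℝ) ^ 5 ≤ n)
    (hxy : 7 / 3 ≤ x + y) (hy : 0.49 ≤ y) (hy1 : y ≤ 1) :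
    1.1038 * offlineCost earlyFlood n (1 + 16 / 5) 0 ≤ smithContinuation earlyFlood n x y := by
  have hparts : 1 / (n : ℝ) ≤ 1 / 10 ^ 5 := one_div_le_one_div_of_le (by norm_num) hn
  have hlong : min (7 / 3 * (16 / 5)) (28 / 5 * x) = 7 / 3 * (16 / 5) :=
    min_eq_left (by linarith)
  simp only [offlineCost, smithContinuation, earlyFlood, hlong]
  rcases min_cases (7 / 3 * y) x with h | h <;>
    rcases min_cases (16 / 5) (28 / 5 * y) with h' | h' <;> linarith

lemma ratio_mul_le_smithContinuation_lateFlood {n : ℕ} {x y : ℝ} (hn : (10 : ℝ) ^ 5 ≤ n)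
    (hxy : 1 ≤ x + y) (hy0 : 0 ≤ y) (hy : y ≤ 0.49) :
    1.1038 * offlineCost lateFlood n 0 (7 / 3 + 11 / 4) ≤ smithContinuation lateFlood n x y := by
  have hparts : 1 / (n : ℝ) ≤ 1 / 10 ^ 5 := one_div_le_one_div_of_le (by norm_num) hn
  simp only [offlineCost, smithContinuation, lateFlood]
  rcases min_cases (7 / 3 * y) x with h | h <;>
    rcases min_cases (7 / 3 * (11 / 4)) (77 / 12 * x) with h' | h' <;>
    rcases min_cases (11 / 4) (77 / 12 * y) with h'' | h'' <;> linarith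

lemma ratio_mul_le_smithContinuation_lateFlood_zero {n : ℕ} {x : ℝ} (hn : (10 : ℝ) ^ 5 ≤ n)
    (hx : 1 ≤ x) :
    1.1038 * offlineCost lateFlood n 0 (7 / 3 + 11 / 4) ≤
      smithContinuation lateFlood n x 0 - (lateFlood.release - 1) := by
  have hparts : 1 / (n : ℝ) ≤ 1 / 10 ^ 5 := one_div_le_one_div_of_le (by norm_num) hn
  have hlong : min (7 / 3 * (11 / 4)) (77 / 12 * x) = 7 / 3 * (11 / 4) :=
    min_eq_left (by linarith)
  have hshort : min 0 x = 0 := min_eq_left (by linarith)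
  have hflood : min (11 / 4 : ℝ) 0 = 0 := min_eq_right (by norm_num)
  simp only [offlineCost, smithContinuation, lateFlood, mul_zero, hlong, hshort, hflood]
  linarith

variable {n : ℕ} [NeZero n] {F : Job} {σ : ℝ → Option ℕ}

lemma optimalCost_floodedBase_le {a b : ℝ} (ha : 0 ≤ a) (hb : 0 ≤ b)
    (hab : Disjoint (Set.Ico a (a + 7 / 3)) (Set.Ico b (b + 1)))
    (haF : Disjoint (Set.Ico a (a + 7 / 3)) (Set.Ico F.release (F.release + F.proc)))
    (hbF : Disjoint (Set.Ico b (b + 1)) (Set.Ico F.release (F.release + F.proc))) :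
    optimalCost (floodedBase F n) ≤ offlineCost F n a b := by
  have hstart : IsStartDates baseInstance ![a, b] :=
    ⟨Fin.forall_fin_two.2 ⟨ha, hb⟩, Fin.forall_fin_two.2
      ⟨Fin.forall_fin_two.2 ⟨fun h => absurd rfl h, fun _ => hab⟩,
        Fin.forall_fin_two.2 ⟨fun _ => hab.symm, fun h => absurd rfl h⟩⟩⟩
  refine (hstart.optimalCost_flood_le (release_le_of_mem_baseInstance F)
    (Fin.forall_fin_two.2 ⟨haF, hbF⟩)).trans_eq ?_
  congr 1
  refine (Fin.sum_univ_two _).trans ?_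
  simp [baseInstance, longJob, shortJob]

/-- The long (`0`) and the short (`1`) job as jobs of `floodedBase F n`. -/
noncomputable def baseIndex (F : Job) (n : ℕ) [NeZero n] (i : Fin 2) :
    Fin (floodedBase F n).jobs.length :=
  JobInstance.floodEquiv (release_le_of_mem_baseInstance F) n (.inl i)

lemma smithContinuation_le_add (h : IsSchedule (floodedBase F n) σ)
    (hlong : processedReal σ 0 F.release < 7 / 3) :
    smithContinuation F n (7 / 3 - processedReal σ 0 F.release) (1 - processedReal σ 1 F.release)
      ≤ totalWeightedCompletionTime (floodedBase F n) σ
        + max (F.release - completionTime (floodedBase F n) σ (baseIndex F n 1)) 0 := by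
  have hzero : max (F.release - completionTime (floodedBase F n) σ (baseIndex F n 0)) 0 = 0 :=
    max_eq_right (sub_nonpos.2 (h.le_completionTime_of_remaining_pos _ (sub_pos.2 hlong)))
  have hsum (f : Fin baseInstance.jobs.length → ℝ) : ∑ i, f i = f (0 : Fin 2) + f (1 : Fin 2) :=
    Fin.sum_univ_two f
  have hsmith (w x : Fin baseInstance.jobs.length → ℝ) : smithCost w x = _ :=
    smithCost_fin_two w x
  have hbound := IsSchedule.smithCost_flood_le h
  rw [hsmith, hsum, hsum, hsum] at hbound
  change (7 / 3 + 1) * F.release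
    + (7 / 3 * (7 / 3 - processedReal σ 0 F.release) + 1 * (1 - processedReal σ 1 F.release)
      + min (7 / 3 * (1 - processedReal σ 1 F.release))
          (1 * (7 / 3 - processedReal σ 0 F.release)))
    + (min (7 / 3 * F.proc) (F.weight * (7 / 3 - processedReal σ 0 F.release))
      + min (1 * F.proc) (F.weight * (1 - processedReal σ 1 F.release)))
    + F.weight * (F.release + F.proc * (1 + 1 / n) / 2)
    ≤ totalWeightedCompletionTime (floodedBase F n) σ
      + (7 / 3 * max (F.release - completionTime (floodedBase F n) σ (baseIndex F n 0)) 0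
        + 1 * max (F.release - completionTime (floodedBase F n) σ (baseIndex F n 1)) 0) at hbound
  rw [hzero] at hbound
  simp only [one_mul] at hbound
  unfold smithContinuation
  linarith

lemma smithContinuation_le (h : IsSchedule (floodedBase F n) σ)
    (hlong : processedReal σ 0 F.release < 7 / 3) (hshort : processedReal σ 1 F.release < 1) :
    smithContinuation F n (7 / 3 - processedReal σ 0 F.release) (1 - processedReal σ 1 F.release)
      ≤ totalWeightedCompletionTime (floodedBase F n) σ := by
  refine (smithContinuation_le_add h hlong).trans_eq ?_
  rw [max_eq_right, add_zero]
  exact sub_nonpos.2 (h.le_completionTime_of_remaining_pos (baseIndex F n 1) (sub_pos.2 hshort))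

lemma smithContinuation_le_add_release_sub_one (h : IsSchedule (floodedBase F n) σ)
    (hlong : processedReal σ 0 F.release < 7 / 3) (hF : 1 ≤ F.release) :
    smithContinuation F n (7 / 3 - processedReal σ 0 F.release) (1 - processedReal σ 1 F.release)
      ≤ totalWeightedCompletionTime (floodedBase F n) σ + (F.release - 1) := by
  have hC : 0 + 1 ≤ completionTime (floodedBase F n) σ (baseIndex F n 1) :=
    h.release_add_proc_le_completionTime (baseIndex F n 1)
  refine (smithContinuation_le_add h hlong).trans ?_
  gcongr
  exact max_le (by linarith) (by linarith)

lemma processedReal_add_le (h : IsSchedule (floodedBase F n) σ) {t : ℝ} (ht : 0 ≤ t) :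
    processedReal σ 0 t + processedReal σ 1 t ≤ t :=
  (Fin.sum_univ_two _).symm.trans_le (IsSchedule.sum_processedReal_flood_le h ht)

lemma offlineCost_pos (F : Job) (n : ℕ) {a b : ℝ} (ha : 0 ≤ a) (hb : 0 ≤ b) :
    0 < offlineCost F n a b := by
  have := F.release_nonneg
  have := F.proc_pos
  have := F.weight_nonneg
  unfold offlineCost
  positivity

lemma optimalCost_earlyFlood_le :
    optimalCost (floodedBase earlyFlood n) ≤ offlineCost earlyFlood n (1 + 16 / 5) 0 := by
  refine optimalCost_floodedBase_le (by norm_num) le_rfl ?_ ?_ ?_ <;>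
    rw [Set.Ico_disjoint_Ico] <;> norm_num [earlyFlood]

lemma optimalCost_lateFlood_le :
    optimalCost (floodedBase lateFlood n) ≤ offlineCost lateFlood n 0 (7 / 3 + 11 / 4) := by
  refine optimalCost_floodedBase_le le_rfl (by norm_num) ?_ ?_ ?_ <;>
    rw [Set.Ico_disjoint_Ico] <;> norm_num [lateFlood]

lemma le_competitiveRatio_of_short_le (A : OnlineAlgorithm) (hn : (10 : ℝ) ^ 5 ≤ n)
    (hshort : processedReal (A.schedule (floodedBase earlyFlood n)) 1 1 ≤ 0.51) :
    ((1.1038 : ℝ) : EReal) ≤ A.competitiveRatio := by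
  have h : IsSchedule (floodedBase earlyFlood n) (A.schedule (floodedBase earlyFlood n)) :=
    A.feasible _
  have hbusy := processedReal_add_le h zero_le_one
  have hnonneg := processedReal_nonneg (A.schedule (floodedBase earlyFlood n)) 1 1
  refine A.le_competitiveRatio (by norm_num) (offlineCost_pos _ _ (by norm_num) le_rfl)
    (optimalCost_earlyFlood_le (n := n)) ?_
  refine (ratio_mul_le_smithContinuation_earlyFlood hn ?_ ?_ ?_).trans
    (smithContinuation_le h ?_ ?_) <;> rw [show earlyFlood.release = 1 from rfl] <;> linarith

lemma le_competitiveRatio_of_le_short (A : OnlineAlgorithm) (hn : (10 : ℝ) ^ 5 ≤ n)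
    (hshort : 0.51 ≤ processedReal (A.schedule (floodedBase lateFlood n)) 1 1) :
    ((1.1038 : ℝ) : EReal) ≤ A.competitiveRatio := by
  set σ := A.schedule (floodedBase lateFlood n)
  have h : IsSchedule (floodedBase lateFlood n) σ := A.feasible _
  have hrel : lateFlood.release = 7 / 3 := rfl
  have hbusy := processedReal_add_le h lateFlood.release_nonneg
  have hmono : processedReal σ 1 1 ≤ processedReal σ 1 lateFlood.release :=
    h.processedReal_mono (baseIndex lateFlood n 1) (by rw [hrel]; norm_num)
  have hle : processedReal σ 1 lateFlood.release ≤ 1 :=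
    h.processedReal_le (baseIndex lateFlood n 1) _
  have hlong : processedReal σ 0 lateFlood.release < 7 / 3 := by linarith
  refine A.le_competitiveRatio (by norm_num) (offlineCost_pos _ _ le_rfl (by norm_num))
    (optimalCost_lateFlood_le (n := n)) ?_
  rcases hle.lt_or_eq with hlt | hdone
  · exact (ratio_mul_le_smithContinuation_lateFlood hn (by linarith) (by linarith)
      (by linarith)).trans (smithContinuation_le h hlong hlt)
  · have hcost := smithContinuation_le_add_release_sub_one h hlong (by rw [hrel]; norm_num)
    rw [hdone, sub_self] at hcost
    linarith [ratio_mul_le_smithContinuation_lateFlood_zero hn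
      (x := 7 / 3 - processedReal σ 0 lateFlood.release) (by linarith)]

end Adversary

theorem theorem2 (A : OnlineAlgorithm) : ((1.1038 : ℝ) : EReal) ≤ A.competitiveRatio := by
  let n : ℕ := 10 ^ 5
  have : NeZero n := ⟨by norm_num [n]⟩
  have hn : (10 : ℝ) ^ 5 ≤ n := by norm_num [n]
  have hsame : processedReal (A.schedule (floodedBase earlyFlood n)) 1 1
      = processedReal (A.schedule (floodedBase lateFlood n)) 1 1 := by
    refine A.processedReal_schedule_congr (fun s hs => ?_) 1
    exact (JobInstance.known_flood_of_lt hs).trans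
      (JobInstance.known_flood_of_lt (hs.trans (by norm_num [lateFlood]))).symm
  rcases le_total (processedReal (A.schedule (floodedBase earlyFlood n)) 1 1) 0.51 with h | h
  · exact le_competitiveRatio_of_short_le A hn h
  · exact le_competitiveRatio_of_le_short A hn (hsame ▸ h)
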